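/- Consider a source and $n\ge 2$ nodes. The source generates new versions of its information at the points of a Poisson process of rate $\lambda_e>0$, and sends its current version to each node at the points of a Poisson process of rate $\lambda/n$, where $\lambda>0$. In the semi-distributed gossip scheme with gossip rate $B>0$, a node that is updated by the source sends a pilot signal to all other nodes and then gossips, transmitting its version to each of the $n-1$ other nodes at the points of a Poisson process of rate $B/(n-1)$, until the source updates some other node (whose pilot signal makes it stop). All these Poisson processes are independent. A node that receives a gossip transmission keeps the fresher of its own version and the received one. The network starts at time $0$ from fixed versions, none newer than the source's, with no node gossiping. Let $\Delta_i(t)$ be the version age of node $i$ at time $t$, i.e. the number of the source's current version minus that of the version stored at node $i$. Then, for every $n\ge2$, $B>0$ and every node $i$, $\mathbb{E}[\Delta_i(t)]$ is finite for all $t\ge0$, and the steady-state mean version age $a_i=\lim_{t\to\infty}\mathbb{E}[\Delta_i(t)]$ exists and equals $$a_i=\frac{\lambda_e+\frac{B}{n-1}\cdot\frac{\lambda_e}{\lambda}}{\frac{\lambda}{n}+\frac{B}{n-1}}.$$ In particular, if $B=n\lambda$ with $\lambda_e,\lambda$ fixed, then $a_i=O(1)$ as $n\to\infty$, and $\lim_{n\to\infty}a_i=2\lambda_e/\lambda$.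 -/

import Mathlib

open MeasureTheory ProbabilityTheory Filter Topology Asymptotics
open scoped NNReal

/-- A (homogeneous) Poisson process of rate `r`: a counting process started at `0`, with
nondecreasing right-continuous paths and independent increments, the increment over `(s, t]` being
Poisson distributed with mean `r * (t - s)`. -/
structure IsPoissonProcess {Ω : Type*} [MeasurableSpace Ω] (P : Measure Ω) (r : ℝ≥0)
    (N : ℝ≥0 → Ω → ℕ) : Prop where
  measurable : ∀ t, Measurable (N t)
  zero : ∀ᵐ ω ∂P, N 0 ω = 0
  mono : ∀ᵐ ω ∂P, Monotone fun t => N t ω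
  rightCont : ∀ᵐ ω ∂P, ∀ t, ContinuousWithinAt (fun s => N s ω) (Set.Ici t) t
  law_increment : ∀ s t, s ≤ t →
    HasLaw (fun ω => N t ω - N s ω) (poissonMeasure (r * (t - s))) P
  indep_increments : HasIndepIncrements N P

namespace Gossip

/-- The kinds of events in a network with a source and `n` nodes. -/
inductive Event (n : ℕ) : Type
  /-- The source updates itself, i.e. a new version is generated. -/
  | selfUpdate : Event n
  /-- The source sends its current version to node `i`. -/
  | sourceTo (i : Fin n) : Event n
  /-- A transmission opportunity from node `j` to another node `l`; it is used only
  if `j` is gossiping. -/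
  | gossip (j l : Fin n) (h : j ≠ l) : Event n

/-- The rates of the events. When a node gossips, it does so with total rate `B`, i.e. with
rate `B / (n - 1)` to each of the `n - 1` other nodes. -/
noncomputable def rate {n : ℕ} (lamE lam B : ℝ≥0) : Event n → ℝ≥0
  | .selfUpdate => lamE
  | .sourceTo _ => lam / n
  | .gossip _ _ _ => B / ((n - 1 : ℕ) : ℝ≥0)

/-- The state of the network: the version at the source, the versions at the nodes, and the node
that is currently gossiping (`none` as long as the source has not updated any node). -/
structure NetState (n : ℕ) : Type where
  source : ℕ
  node : Fin n → ℕ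
  gossiper : Option (Fin n)

/-- The state space is countable and carries the discrete σ-algebra. -/
instance (n : ℕ) : MeasurableSpace (NetState n) := ⊤

/-- The version age of node `i`: the number of versions by which it lags behind the source. -/
def NetState.age {n : ℕ} (x : NetState n) (i : Fin n) : ℝ := (x.source : ℝ) - (x.node i : ℝ)

/-- The effect of an event in the semi-distributed scheme. A node that is updated by the source
starts gossiping and its pilot signal stops all the other nodes; the receiver of
a gossip transmission keeps the fresher of the two versions. -/
def step {n : ℕ} : Event n → NetState n → NetState n
  | .selfUpdate, x => { x with source := x.source + 1 }
  | .sourceTo i, x =>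
      { x with node := Function.update x.node i x.source, gossiper := some i }
  | .gossip j l _, x =>
      if x.gossiper = some j then
        { x with node := Function.update x.node l (max (x.node j) (x.node l)) }
      else x

/-- `X` is the state process of the semi-distributed gossip network with `n` nodes, source
self-update rate `lamE`, total source-to-network rate `lam` and gossip rate `B`, driven by the
independent Poisson processes `N e`, one for each kind `e` of event. It starts without a gossiping
node from some fixed versions; it does not change on a time interval `(s, t]` without events, and
it changes by `step e` if exactly one event occurs in `(s, t]` and is of kind `e`. (Almost surely
no two events are simultaneous, so this determines `X` from its initial state.) -/
structure IsSemiDistributed {Ω : Type*} [MeasurableSpace Ω] (P : Measure Ω) (n : ℕ)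
    (lamE lam B : ℝ≥0) (N : Event n → ℝ≥0 → Ω → ℕ) (X : ℝ≥0 → Ω → NetState n) : Prop where
  poisson : ∀ e, IsPoissonProcess P (rate lamE lam B e) (N e)
  indep : iIndepFun (fun (e : Event n) (ω : Ω) (t : ℝ≥0) => N e t ω) P
  measurable : ∀ t, Measurable (X t)
  init : ∃ x₀ : NetState n, x₀.gossiper = none ∧ (∀ i, x₀.node i ≤ x₀.source) ∧
    ∀ᵐ ω ∂P, X 0 ω = x₀
  no_event : ∀ᵐ ω ∂P, ∀ s t, s ≤ t → (∀ e, N e t ω = N e s ω) → X t ω = X s ω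
  one_event : ∀ᵐ ω ∂P, ∀ s t, s ≤ t → ∀ e, N e t ω = N e s ω + 1 →
    (∀ e', e' ≠ e → N e' t ω = N e' s ω) → X t ω = step e (X s ω)

end Gossip

/-! The gossiping node is always the freshest of the nodes: it took the source's current version,
and until the next source transmission no node can obtain a newer one. A gossip transmission to node
i therefore replaces the age A of i by the gossiper's age D. If i itself gossips, or nobody does
yet, D is the age of i, so a fictitious transmission to i changes nothing. Gossip may thus be taken
to reach i at the constant rate σ = B/(n-1), and the means satisfy D' = λe - λD and A' = λe - (λ/n)A
+ σ(D - A). This triangular linear system is exponentially stable; its fixed point is D = λe/λ, A =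
(λe + σλe/λ)/(λ/n + σ).

The proof replaces the differential equations by exact recurrences on a grid of m + 1 cells of (0,
t]. The means of a chain driven by the independent cell counts evolve linearly
(`integral_gossiperAge_succ`, `integral_nodeAge_succ`), and the chain follows the network as long as
no cell has two events (`matches_chain`). Crowded cells have probability O(1/m), and the ages are
dominated by an integrable variable independent of m, so the chain's mean tends to the mean age
(`exists_tendsto_gridChain`). Bounding the recurrences and letting m → ∞ leaves an error (x +
yt)exp(-ct) (`abs_limit_sub_le`). -/

/-! ### Poisson distributions: mean and small-parameter bounds -/

section Poisson

lemma hasSum_poissonMeasure_weight_mul_cast (r : ℝ≥0) :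
    HasSum (fun n : ℕ => Real.exp (-r) * (r : ℝ) ^ n / (n.factorial : ℝ) * n) r := by
  rw [← hasSum_nat_add_iff' 1]
  have h := (hasSum_one_poissonMeasure r).mul_left (r : ℝ)
  simp only [Finset.range_one, Finset.sum_singleton, Nat.cast_zero, mul_zero, sub_zero]
  rw [mul_one] at h
  refine HasSum.congr_fun h fun n => ?_
  rw [Nat.factorial_succ]
  push_cast
  field_simp
  ring

lemma integrable_cast_poissonMeasure (r : ℝ≥0) :
    Integrable (fun n : ℕ => (n : ℝ)) (poissonMeasure r) := by
  rw [integrable_poissonMeasure_iff]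
  simpa using (hasSum_poissonMeasure_weight_mul_cast r).summable

lemma integral_cast_poissonMeasure (r : ℝ≥0) :
    ∫ n : ℕ, (n : ℝ) ∂poissonMeasure r = r := by
  rw [integral_poissonMeasure]
  simpa using (hasSum_poissonMeasure_weight_mul_cast r).tsum_eq

lemma poissonMeasure_real_zero (r : ℝ≥0) :
    (poissonMeasure r).real {0} = Real.exp (-r) := by
  simp [poissonMeasure_real_singleton]

lemma poissonMeasure_real_ne_zero_le (r : ℝ≥0) :
    (poissonMeasure r).real {x | x ≠ 0} ≤ r := by
  have h : {x : ℕ | x ≠ 0} = {0}ᶜ := by ext; simp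
  rw [h, probReal_compl_eq_one_sub (MeasurableSet.of_discrete), poissonMeasure_real_zero]
  linarith [Real.add_one_le_exp (-(r : ℝ))]

lemma poissonMeasure_real_two_le_le (r : ℝ≥0) :
    (poissonMeasure r).real {x | 2 ≤ x} ≤ (r : ℝ) ^ 2 := by
  have h : {x : ℕ | 2 ≤ x} = ({0} ∪ {1})ᶜ := by
    ext x
    simp only [Set.mem_ofPred_eq, Set.mem_compl_iff, Set.mem_union, Set.mem_singleton_iff]
    omega
  rw [h, probReal_compl_eq_one_sub (MeasurableSet.of_discrete),
    measureReal_union (by simp) (MeasurableSet.of_discrete), poissonMeasure_real_zero,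
    poissonMeasure_real_singleton]
  simp only [pow_one, Nat.factorial_one, Nat.cast_one, div_one]
  -- The mass of {0, 1} is (1 + r)exp(-r) ≥ (1 + r)(1 - r).
  nlinarith [Real.add_one_le_exp (-(r : ℝ)), r.coe_nonneg]

end Poisson

/-! ### Independent Poisson cells and the rarity of crowded ones -/

/-- An array of independent Poisson variables, those in row `e` having mean `ρ e`. -/
structure IsPoissonArray {Ω ι : Type*} [MeasurableSpace Ω] (P : Measure Ω) (ρ : ι → ℝ≥0)
    (η : ι → ℕ → Ω → ℕ) : Prop where
  measurable : ∀ e k, Measurable (η e k)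
  law : ∀ e k, HasLaw (η e k) (poissonMeasure (ρ e)) P
  indep : iIndepFun (fun (p : ι × ℕ) ω => η p.1 p.2 ω) P

/-- The increments over a grid of mesh `h` of a counting process. -/
def gridIncrement {Ω : Type*} (N : ℝ≥0 → Ω → ℕ) (h : ℝ≥0) (k : ℕ) (ω : Ω) : ℕ :=
  N ((k + 1 : ℕ) * h) ω - N (k * h) ω

/-- Joint independence combines independence of the processes across rows with independence of
increments within each row. -/
lemma isPoissonArray_gridIncrement {Ω ι : Type*} [MeasurableSpace Ω] {P : Measure Ω}
    {r : ι → ℝ≥0} {N : ι → ℝ≥0 → Ω → ℕ} (hN : ∀ e, IsPoissonProcess P (r e) (N e))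
    (hind : iIndepFun (fun (e : ι) (ω : Ω) (t : ℝ≥0) => N e t ω) P) (h : ℝ≥0) :
    IsPoissonArray P (fun e => r e * h) (fun e => gridIncrement (N e) h) where
  measurable e k := ((hN e).measurable _).sub ((hN e).measurable _)
  law e k := by
    have hle : (k : ℝ≥0) * h ≤ (k + 1 : ℕ) * h := by gcongr; simp
    have := (hN e).law_increment _ _ hle
    have e1 : ((k + 1 : ℕ) : ℝ≥0) * h - k * h = h := by
      push_cast
      rw [add_mul, one_mul, add_tsub_cancel_left]
    rwa [e1] at this
  indep := by
    have hmeas : ∀ e k, Measurable (gridIncrement (N e) h k) := fun e k =>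
      ((hN e).measurable _).sub ((hN e).measurable _)
    refine iIndepFun_uncurry' (X := fun e k => gridIncrement (N e) h k) hmeas ?_ fun e => ?_
    · refine hind.comp (fun _ (f : ℝ≥0 → ℕ) (k : ℕ) => f ((k + 1 : ℕ) * h) - f (k * h)) fun e => ?_
      exact measurable_pi_lambda _ fun k => (measurable_pi_apply _).sub (measurable_pi_apply _)
    · refine (hN e).indep_increments.nat (t := fun k : ℕ => (k : ℝ≥0) * h) fun a b hab => ?_
      dsimp only
      gcongr

/-- A cell contains at most one event. -/
def AtMostOneEvent {ι : Type*} (x : ι → ℕ) : Prop :=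
  (∀ e, x e = 0) ∨ ∃ e, x e = 1 ∧ ∀ e', e' ≠ e → x e' = 0

lemma atMostOneEvent_of_forall {ι : Type*} {x : ι → ℕ} (h2 : ∀ e, x e < 2)
    (hne : ∀ e e', e ≠ e' → x e ≠ 0 → x e' = 0) : AtMostOneEvent x := by
  by_cases h : ∀ e, x e = 0
  · exact Or.inl h
  · push Not at h
    obtain ⟨e, he⟩ := h
    refine Or.inr ⟨e, ?_, fun e' he' => hne e e' he'.symm he⟩
    have := h2 e
    omega

namespace IsPoissonArray

variable {Ω ι : Type*} [MeasurableSpace Ω] {P : Measure Ω}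
  {ρ : ι → ℝ≥0} {η : ι → ℕ → Ω → ℕ}

lemma integrable (hη : IsPoissonArray P ρ η) (e : ι) (k : ℕ) :
    Integrable (fun ω => (η e k ω : ℝ)) P := by
  have h := integrable_cast_poissonMeasure (ρ e)
  rw [← (hη.law e k).map_eq] at h
  exact h.comp_measurable (hη.measurable e k)

lemma integral_eq (hη : IsPoissonArray P ρ η) (e : ι) (k : ℕ) :
    ∫ ω, (η e k ω : ℝ) ∂P = ρ e := by
  rw [← integral_cast_poissonMeasure (ρ e)]
  exact (hη.law e k).integral_comp (f := fun n : ℕ => (n : ℝ))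
    (Measurable.of_discrete.aestronglyMeasurable)

lemma real_forall_eq_zero (hη : IsPoissonArray P ρ η) (S : Finset ι) (k : ℕ) :
    P.real {ω | ∀ e ∈ S, η e k ω = 0} = Real.exp (-∑ e ∈ S, (ρ e : ℝ)) := by
  have hind : iIndepFun (fun e => η e k) P :=
    hη.indep.precomp (g := fun e : ι => (e, k)) fun a b h => congrArg Prod.fst h
  have h := hind.measure_inter_preimage_eq_mul S (sets := fun _ => {0})
    (fun _ _ => MeasurableSet.of_discrete)
  have hset : {ω | ∀ e ∈ S, η e k ω = 0} = ⋂ e ∈ S, η e k ⁻¹' {0} := by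
    ext; simp
  rw [hset, measureReal_def, h, ENNReal.toReal_prod, ← Finset.sum_neg_distrib, Real.exp_sum]
  refine Finset.prod_congr rfl fun e _ => ?_
  rw [← poissonMeasure_real_zero]
  exact (hη.law e k).measureReal_eq (p := fun x => x = 0) MeasurableSet.of_discrete

lemma real_two_le_le (hη : IsPoissonArray P ρ η) (e : ι) (k : ℕ) :
    P.real {ω | 2 ≤ η e k ω} ≤ (ρ e : ℝ) ^ 2 := by
  rw [(hη.law e k).measureReal_eq (p := fun x => 2 ≤ x) MeasurableSet.of_discrete]
  exact poissonMeasure_real_two_le_le _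

lemma real_ne_zero_and_ne_zero_le (hη : IsPoissonArray P ρ η) {e e' : ι} (he : e ≠ e') (k : ℕ) :
    P.real {ω | η e k ω ≠ 0 ∧ η e' k ω ≠ 0} ≤ ρ e * ρ e' := by
  have hind : IndepFun (η e k) (η e' k) P :=
    hη.indep.indepFun (i := (e, k)) (j := (e', k)) fun h => he (congrArg Prod.fst h)
  have h := hind.measure_inter_preimage_eq_mul {x | x ≠ 0} {x | x ≠ 0}
    MeasurableSet.of_discrete MeasurableSet.of_discrete
  have hset : {ω | η e k ω ≠ 0 ∧ η e' k ω ≠ 0} =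
      η e k ⁻¹' {x | x ≠ 0} ∩ η e' k ⁻¹' {x | x ≠ 0} := rfl
  rw [hset, measureReal_def, h, ENNReal.toReal_mul]
  have h1 : ∀ e, (P (η e k ⁻¹' {x | x ≠ 0})).toReal ≤ ρ e := fun e =>
    ((hη.law e k).measureReal_eq (p := fun x => x ≠ 0) MeasurableSet.of_discrete).trans_le
      (poissonMeasure_real_ne_zero_le _)
  exact mul_le_mul (h1 e) (h1 e') ENNReal.toReal_nonneg (ρ e).coe_nonneg

/-- Union bound: either some kind occurs twice or two kinds both occur. The bound is quadratic in
the mesh, so summing over the cells of a fixed interval still leaves a factor of the mesh. -/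
lemma real_not_atMostOneEvent_le [Fintype ι] [IsProbabilityMeasure P]
    (hη : IsPoissonArray P ρ η) (k : ℕ) :
    P.real {ω | ¬ AtMostOneEvent fun e => η e k ω} ≤
      ∑ e, (ρ e : ℝ) ^ 2 + ∑ e, ∑ e', (ρ e : ℝ) * ρ e' := by
  have hsub : {ω | ¬ AtMostOneEvent fun e => η e k ω} ⊆
      (⋃ e, {ω | 2 ≤ η e k ω}) ∪
        ⋃ e, ⋃ e', {ω | e ≠ e' ∧ η e k ω ≠ 0 ∧ η e' k ω ≠ 0} := by
    intro ω hω
    by_contra hc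
    simp only [Set.mem_union, Set.mem_iUnion, Set.mem_ofPred_eq, not_or, not_exists, not_le,
      not_and, not_not] at hc
    exact hω (atMostOneEvent_of_forall hc.1 hc.2)
  refine (measureReal_mono hsub).trans ((measureReal_union_le _ _).trans (add_le_add ?_ ?_))
  · exact (measureReal_iUnion_fintype_le _).trans
      (Finset.sum_le_sum fun e _ => hη.real_two_le_le e k)
  · refine (measureReal_iUnion_fintype_le _).trans (Finset.sum_le_sum fun e _ => ?_)
    refine (measureReal_iUnion_fintype_le _).trans (Finset.sum_le_sum fun e' _ => ?_)
    by_cases he : e = e'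
    · simp only [he, ne_eq, not_true_eq_false, false_and, Set.ofPred_false, measureReal_empty]
      positivity
    · simpa [he] using hη.real_ne_zero_and_ne_zero_le he k

lemma real_exists_not_atMostOneEvent_le [Fintype ι] [IsProbabilityMeasure P]
    (hη : IsPoissonArray P ρ η) (m : ℕ) :
    P.real {ω | ∃ k < m, ¬ AtMostOneEvent fun e => η e k ω} ≤
      m * (∑ e, (ρ e : ℝ) ^ 2 + ∑ e, ∑ e', (ρ e : ℝ) * ρ e') := by
  have hset : {ω | ∃ k < m, ¬ AtMostOneEvent fun e => η e k ω} =
      ⋃ k ∈ Finset.range m, {ω | ¬ AtMostOneEvent fun e => η e k ω} := by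
    ext; simp
  rw [hset]
  refine (measureReal_biUnion_finset_le _ _).trans ?_
  refine (Finset.sum_le_sum fun k _ => hη.real_not_atMostOneEvent_le k).trans ?_
  simp [mul_add]

end IsPoissonArray

/-! ### The discrete chain following one node -/

namespace Gossip

instance (n : ℕ) : Finite (Event n) := by
  refine Finite.of_injective (β := Option (Fin n ⊕ Fin n × Fin n))
    (fun e => match e with
      | .selfUpdate => none
      | .sourceTo i => some (.inl i)
      | .gossip j l _ => some (.inr (j, l))) ?_
  intro a b
  cases a <;> cases b <;> simp

noncomputable instance (n : ℕ) : Fintype (Event n) := Fintype.ofFinite _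

/-- The state of a discrete chain that follows node `i`: the age of the gossiping node (or of node
`i` if there is none), the age of node `i`, and the node other than `i` from which node `i` may
receive a gossip transmission. -/
abbrev ChainState {n : ℕ} (i : Fin n) : Type := ℕ × ℕ × {j : Fin n // j ≠ i}

open Classical in
/-- The effect on the chain of a cell with `x e` events of kind `e`. It agrees with that of `step`
for cells with at most one event, and is chosen so that the mean ages evolve linearly. -/
noncomputable def chainStep {n : ℕ} (i : Fin n) (x : Event n → ℕ) (s : ChainState i) :
    ChainState i :=
  ((if ∀ l, x (.sourceTo l) = 0 then s.1 else 0) + x .selfUpdate,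
    (if x (.sourceTo i) = 0 then (if x (.gossip s.2.2 i s.2.2.2) = 0 then s.2.1 else s.1) else 0)
      + x .selfUpdate,
    if h : ∃ l : {j : Fin n // j ≠ i}, x (.sourceTo l) ≠ 0 then h.choose else s.2.2)

/-- The chain started at `s₀` and driven by the cells `x 0, x 1, …`. -/
noncomputable def chain {n : ℕ} (i : Fin n) (s₀ : ChainState i) (x : ℕ → Event n → ℕ) :
    ℕ → ChainState i
  | 0 => s₀
  | k + 1 => chainStep i (x k) (chain i s₀ x k)

/-- A cell can only keep an age, replace it by the other age or reset it, before adding the new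
versions. This domination yields integrability and controls the error on crowded grids. -/
lemma chain_le {n : ℕ} (i : Fin n) (a₀ : ℕ) (j : {j : Fin n // j ≠ i}) (x : ℕ → Event n → ℕ)
    (k : ℕ) :
    (chain i (a₀, a₀, j) x k).1 ≤ a₀ + ∑ l ∈ Finset.range k, x l .selfUpdate ∧
    (chain i (a₀, a₀, j) x k).2.1 ≤ a₀ + ∑ l ∈ Finset.range k, x l .selfUpdate := by
  induction k with
  | zero => simp [chain]
  | succ k ih =>
    obtain ⟨h1, h2⟩ := ih
    rw [Finset.sum_range_succ]
    simp only [chain, chainStep]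
    constructor <;> split_ifs <;> omega

/-- The state after k cells depends on those cells only; the supremum of σ-algebras is the form
needed for independence from cell k. -/
lemma measurable_chain_iSup {Ω : Type*} {n : ℕ} {η : Event n → ℕ → Ω → ℕ}
    (i : Fin n) (s₀ : ChainState i) (k : ℕ) :
    Measurable[⨆ p ∈ {p : Event n × ℕ | p.2 < k}, MeasurableSpace.comap (η p.1 p.2) inferInstance]
      (fun ω => chain i s₀ (fun k e => η e k ω) k) := by
  induction k with
  | zero => exact measurable_const
  | succ k ih =>
    have hle : (⨆ p ∈ {p : Event n × ℕ | p.2 < k},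
        MeasurableSpace.comap (η p.1 p.2) inferInstance) ≤
        ⨆ p ∈ {p : Event n × ℕ | p.2 < k + 1},
          MeasurableSpace.comap (η p.1 p.2) inferInstance :=
      biSup_mono fun p (hp : p.2 < k) => Nat.lt_succ_of_lt hp
    have hV : Measurable[⨆ p ∈ {p : Event n × ℕ | p.2 < k + 1},
        MeasurableSpace.comap (η p.1 p.2) inferInstance] (fun ω e => η e k ω) := by
      refine @measurable_pi_lambda _ _ _ (_) _ _ fun e => ?_
      refine Measurable.mono (comap_measurable (η e k)) ?_ le_rfl
      exact le_biSup (fun p : Event n × ℕ => MeasurableSpace.comap (η p.1 p.2) inferInstance)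
        (i := (e, k)) (Nat.lt_succ_self k)
    have hf : Measurable fun q : (Event n → ℕ) × ChainState i => chainStep i q.1 q.2 :=
      Measurable.of_discrete
    exact hf.comp (hV.prodMk (ih.mono hle le_rfl))

/-! ### Exact linear recurrences for the mean ages -/

section Expectation

variable {Ω : Type*} [MeasurableSpace Ω] {P : Measure Ω} {n : ℕ} {ρ : Event n → ℝ≥0}
  {η : Event n → ℕ → Ω → ℕ}

lemma measurable_chain (hη : IsPoissonArray P ρ η) (i : Fin n) (s₀ : ChainState i) (k : ℕ) :
    Measurable (fun ω => chain i s₀ (fun k e => η e k ω) k) :=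
  (measurable_chain_iSup i s₀ k).mono (iSup₂_le fun p _ => (hη.measurable p.1 p.2).comap_le) le_rfl

lemma indepFun_cell_chain (hη : IsPoissonArray P ρ η) (i : Fin n) (s₀ : ChainState i) (k : ℕ) :
    IndepFun (fun ω e => η e k ω) (fun ω => chain i s₀ (fun k e => η e k ω) k) P := by
  have hdisj : Disjoint {p : Event n × ℕ | p.2 = k} {p : Event n × ℕ | p.2 < k} := by
    rw [Set.disjoint_left]
    rintro p (hp : p.2 = k) (hp' : p.2 < k)
    omega
  have hI := indep_iSup_of_disjoint (fun p : Event n × ℕ => (hη.measurable p.1 p.2).comap_le)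
    hη.indep hdisj
  rw [IndepFun_iff_Indep]
  refine indep_of_indep_of_le_left (indep_of_indep_of_le_right hI ?_) ?_
  · exact (measurable_chain_iSup i s₀ k).comap_le
  · refine Measurable.comap_le ?_
    refine @measurable_pi_lambda _ _ _ (_) _ _ fun e => ?_
    refine Measurable.mono (comap_measurable (η e k)) ?_ le_rfl
    exact le_biSup (fun p : Event n × ℕ => MeasurableSpace.comap (η p.1 p.2) inferInstance)
      (i := (e, k)) rfl

open Classical in
-- Cell k is independent of the past, so the absence of the events in S factors out of the mean. All
-- coefficients of the recurrences arise in this way.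
lemma integral_indicator_mul_chain (hη : IsPoissonArray P ρ η) (i : Fin n) (s₀ : ChainState i)
    (k : ℕ) (S : Finset (Event n)) (f : ChainState i → ℝ) :
    ∫ ω, (if ∀ e ∈ S, η e k ω = 0 then (1 : ℝ) else 0) *
        f (chain i s₀ (fun k e => η e k ω) k) ∂P =
      Real.exp (-∑ e ∈ S, (ρ e : ℝ)) * ∫ ω, f (chain i s₀ (fun k e => η e k ω) k) ∂P := by
  let g : (Event n → ℕ) → ℝ := fun x => if ∀ e ∈ S, x e = 0 then 1 else 0
  have hg : Measurable g := Measurable.of_discrete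
  have hf : Measurable f := Measurable.of_discrete
  have hV : Measurable fun ω e => η e k ω := measurable_pi_lambda _ fun e => hη.measurable e k
  have h := ((indepFun_cell_chain hη i s₀ k).comp hg hf).integral_mul_eq_mul_integral
    (hg.comp hV).aestronglyMeasurable (hf.comp (measurable_chain hη i s₀ k)).aestronglyMeasurable
  refine h.trans ?_
  congr 1
  rw [← hη.real_forall_eq_zero S k, ← integral_indicator_one]
  · refine integral_congr_ae (ae_of_all _ fun ω => ?_)
    simp [g, Set.indicator_apply]
  · have : {ω | ∀ e ∈ S, η e k ω = 0} = ⋂ e ∈ S, η e k ⁻¹' {0} := by ext; simp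
    rw [this]
    exact S.measurableSet_biInter fun e _ => hη.measurable e k MeasurableSet.of_discrete

open Classical in
lemma integrable_indicator_mul_chain (hη : IsPoissonArray P ρ η) (i : Fin n) (s₀ : ChainState i)
    (k : ℕ) (S : Finset (Event n)) (f : ChainState i → ℝ)
    (hint : Integrable (fun ω => f (chain i s₀ (fun k e => η e k ω) k)) P) :
    Integrable (fun ω => (if ∀ e ∈ S, η e k ω = 0 then (1 : ℝ) else 0) *
        f (chain i s₀ (fun k e => η e k ω) k)) P := by
  let g : (Event n → ℕ) → ℝ := fun x => if ∀ e ∈ S, x e = 0 then 1 else 0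
  have hg : Measurable g := Measurable.of_discrete
  have hV : Measurable fun ω e => η e k ω := measurable_pi_lambda _ fun e => hη.measurable e k
  refine hint.bdd_mul (c := 1) (hg.comp hV).aestronglyMeasurable (ae_of_all _ fun ω => ?_)
  change ‖g _‖ ≤ 1
  simp only [g]
  split_ifs <;> simp

lemma integrable_chain [IsProbabilityMeasure P] (hη : IsPoissonArray P ρ η) (i : Fin n) (a₀ : ℕ)
    (j : {j : Fin n // j ≠ i}) (k : ℕ) (f : ChainState i → ℕ)
    (hf : ∀ s, f s ≤ s.1 ∨ f s ≤ s.2.1) :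
    Integrable (fun ω => (f (chain i (a₀, a₀, j) (fun k e => η e k ω) k) : ℝ)) P := by
  have hb : Integrable (fun ω => (a₀ : ℝ) + ∑ l ∈ Finset.range k, (η .selfUpdate l ω : ℝ)) P :=
    (integrable_const _).add (integrable_finsetSum _ fun l _ => hη.integrable _ _)
  have hfm : Measurable fun s => (f s : ℝ) := Measurable.of_discrete
  refine hb.mono' (hfm.comp (measurable_chain hη i _ k)).aestronglyMeasurable
    (ae_of_all _ fun ω => ?_)
  have h := chain_le i a₀ j (fun k e => η e k ω) k
  rw [Real.norm_of_nonneg (Nat.cast_nonneg _)]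
  have h' := hf (chain i (a₀, a₀, j) (fun k e => η e k ω) k)
  have h'' : f (chain i (a₀, a₀, j) (fun k e => η e k ω) k) ≤
    a₀ + ∑ l ∈ Finset.range k, η .selfUpdate l ω := by omega
  exact_mod_cast h''

lemma integral_gossiperAge_succ [IsProbabilityMeasure P] (hη : IsPoissonArray P ρ η) (i : Fin n)
    (a₀ : ℕ) (j : {j : Fin n // j ≠ i}) (k : ℕ) :
    ∫ ω, ((chain i (a₀, a₀, j) (fun k e => η e k ω) (k + 1)).1 : ℝ) ∂P =
      Real.exp (-∑ l, (ρ (.sourceTo l) : ℝ)) *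
        ∫ ω, ((chain i (a₀, a₀, j) (fun k e => η e k ω) k).1 : ℝ) ∂P + ρ .selfUpdate := by
  classical
  let S : Finset (Event n) := Finset.univ.image Event.sourceTo
  have hint := integrable_chain hη i a₀ j k (fun s => s.1) fun s => Or.inl le_rfl
  have h1 := integral_indicator_mul_chain hη i (a₀, a₀, j) k S fun s => (s.1 : ℝ)
  have h2 := integrable_indicator_mul_chain hη i (a₀, a₀, j) k S (fun s => (s.1 : ℝ)) hint
  have hS : ∑ e ∈ S, (ρ e : ℝ) = ∑ l, (ρ (.sourceTo l) : ℝ) :=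
    Finset.sum_image fun a _ b _ h => by simpa using h
  rw [hS] at h1
  rw [← h1, ← hη.integral_eq .selfUpdate k, ← integral_add h2 (hη.integrable _ _)]
  refine integral_congr_ae (ae_of_all _ fun ω => ?_)
  simp [chain, chainStep, S]

/-- Write A = (A - D) + D. The part D survives a cell unless the source reaches i; the part A - D
must also escape gossip from the current sender. The sender is random, so A - D is split according
to its value; all senders have the same parameter σ, so the pieces recombine. -/
lemma integral_nodeAge_succ [IsProbabilityMeasure P] (hη : IsPoissonArray P ρ η) (i : Fin n)
    (a₀ : ℕ) (j : {j : Fin n // j ≠ i}) (k : ℕ) {σ : ℝ≥0} (hσ : ∀ l h, ρ (.gossip l i h) = σ) :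
    ∫ ω, ((chain i (a₀, a₀, j) (fun k e => η e k ω) (k + 1)).2.1 : ℝ) ∂P =
      Real.exp (-(ρ (.sourceTo i) + σ)) *
        (∫ ω, ((chain i (a₀, a₀, j) (fun k e => η e k ω) k).2.1 : ℝ) ∂P -
          ∫ ω, ((chain i (a₀, a₀, j) (fun k e => η e k ω) k).1 : ℝ) ∂P) +
      Real.exp (-ρ (.sourceTo i)) *
        ∫ ω, ((chain i (a₀, a₀, j) (fun k e => η e k ω) k).1 : ℝ) ∂P + ρ .selfUpdate := by
  classical
  have hD := integrable_chain hη i a₀ j k (fun s => s.1) fun s => Or.inl le_rfl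
  have hA := integrable_chain hη i a₀ j k (fun s => s.2.1) fun s => Or.inr le_rfl
  let f : {j : Fin n // j ≠ i} → ChainState i → ℝ := fun l s =>
    if s.2.2 = l then (s.2.1 : ℝ) - s.1 else 0
  let T : {j : Fin n // j ≠ i} → Finset (Event n) := fun l => {.sourceTo i, .gossip l i l.2}
  have hfi : ∀ l, Integrable (fun ω => f l (chain i (a₀, a₀, j) (fun k e => η e k ω) k)) P := by
    intro l
    have hfm : Measurable (f l) := Measurable.of_discrete
    refine (hA.sub hD).mono (hfm.comp (measurable_chain hη i _ k)).aestronglyMeasurable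
      (ae_of_all _ fun ω => ?_)
    simp only [f]
    split_ifs <;> simp
  have hT : ∀ l, ∑ e ∈ T l, (ρ e : ℝ) = ρ (.sourceTo i) + σ := fun l => by
    simp [T, hσ]
  have h1 := fun l => integral_indicator_mul_chain hη i (a₀, a₀, j) k (T l) (f l)
  have h1' := fun l => integrable_indicator_mul_chain hη i (a₀, a₀, j) k (T l) (f l) (hfi l)
  have h2 := integral_indicator_mul_chain hη i (a₀, a₀, j) k {.sourceTo i} fun s => (s.1 : ℝ)
  have h2' := integrable_indicator_mul_chain hη i (a₀, a₀, j) k {.sourceTo i}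
    (fun s => (s.1 : ℝ)) hD
  rw [Finset.sum_singleton] at h2
  have hsum : ∫ ω, ((chain i (a₀, a₀, j) (fun k e => η e k ω) k).2.1 : ℝ) ∂P -
      ∫ ω, ((chain i (a₀, a₀, j) (fun k e => η e k ω) k).1 : ℝ) ∂P =
      ∑ l, ∫ ω, f l (chain i (a₀, a₀, j) (fun k e => η e k ω) k) ∂P := by
    rw [← integral_sub hA hD, ← integral_finsetSum _ fun l _ => hfi l]
    refine integral_congr_ae (ae_of_all _ fun ω => ?_)
    simp [f]
  rw [hsum, Finset.mul_sum]
  have h3 : ∀ l, Real.exp (-(ρ (.sourceTo i) + σ)) *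
      ∫ ω, f l (chain i (a₀, a₀, j) (fun k e => η e k ω) k) ∂P =
      ∫ ω, (if ∀ e ∈ T l, η e k ω = 0 then (1 : ℝ) else 0) *
        f l (chain i (a₀, a₀, j) (fun k e => η e k ω) k) ∂P := fun l => by rw [h1, hT]
  rw [Finset.sum_congr rfl fun l _ => h3 l, ← integral_finsetSum _ fun l _ => h1' l, ← h2,
    ← hη.integral_eq .selfUpdate k, ← integral_add (integrable_finsetSum _ fun l _ => h1' l) h2']
  refine Eq.trans ?_ (integral_add ((integrable_finsetSum Finset.univ fun l _ => h1' l).add h2')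
    (hη.integrable .selfUpdate k))
  refine integral_congr_ae (ae_of_all _ fun ω => ?_)
  simp only [f, mul_ite, mul_zero, Finset.sum_ite_eq, Finset.mem_univ, if_true]
  simp only [chain, chainStep, T, Finset.mem_insert, Finset.mem_singleton, forall_eq_or_imp,
    forall_eq]
  by_cases ha : η (.sourceTo i) k ω = 0
  · by_cases hb : η (.gossip _ i (chain i (a₀, a₀, j) (fun k e => η e k ω) k).2.2.2) k ω = 0
    · simp [ha, hb]
    · simp [ha, hb]
  · simp [ha]

end Expectation

end Gossip
-- The chain agrees with the network on uncrowded cells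
namespace Gossip

/-- The chain state `s` describes the network state `x` as seen from node `i`. -/
structure Matches {n : ℕ} (i : Fin n) (x : NetState n) (s : ChainState i) : Prop where
  node_le_source : ∀ l, x.node l ≤ x.source
  node_le_gossiper : ∀ j, x.gossiper = some j → ∀ l, x.node l ≤ x.node j
  gossiperAge : s.1 = x.source - x.node (x.gossiper.getD i)
  nodeAge : s.2.1 = x.source - x.node i
  sender : ∀ j, x.gossiper = some j → j ≠ i → (s.2.2 : Fin n) = j

variable {n : ℕ} {i : Fin n} {x : NetState n} {s : ChainState i} {c : Event n → ℕ}

lemma Matches.age_eq (h : Matches i x s) : x.age i = s.2.1 := by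
  rw [h.nodeAge, NetState.age, Nat.cast_sub (h.node_le_source i)]

lemma Matches.chainStep_of_forall_eq_zero (h : Matches i x s) (hc : ∀ e, c e = 0) :
    Matches i x (chainStep i c s) := by
  have : chainStep i c s = s := by simp [chainStep, hc]
  rwa [this]

lemma Matches.chainStep_selfUpdate (h : Matches i x s) (h1 : c .selfUpdate = 1)
    (hc : ∀ e, e ≠ .selfUpdate → c e = 0) :
    Matches i (step .selfUpdate x) (chainStep i c s) := by
  have hs : ∀ l, c (.sourceTo l) = 0 := fun l => hc _ (by simp)
  have hg : ∀ j l hjl, c (.gossip j l hjl) = 0 := fun j l hjl => hc _ (by simp)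
  constructor
  · exact fun l => (h.node_le_source l).trans (Nat.le_succ _)
  · exact h.node_le_gossiper
  · have := h.node_le_source (x.gossiper.getD i)
    simp only [chainStep, hs, h1, step, h.gossiperAge, implies_true, if_true]
    omega
  · have := h.node_le_source i
    simp only [chainStep, hs, hg, h1, step, h.nodeAge, if_true]
    omega
  · simpa [chainStep, hs, step] using h.sender

lemma Matches.chainStep_sourceTo (h : Matches i x s) {j : Fin n} (h1 : c (.sourceTo j) = 1)
    (hc : ∀ e, e ≠ .sourceTo j → c e = 0) :
    Matches i (step (.sourceTo j) x) (chainStep i c s) := by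
  have hu : c .selfUpdate = 0 := hc _ (by simp)
  have hs : ∀ l, l ≠ j → c (.sourceTo l) = 0 := fun l hl => hc _ (by simpa using hl)
  have hg : ∀ j l hjl, c (.gossip j l hjl) = 0 := fun j l hjl => hc _ (by simp)
  have hle : ∀ l, Function.update x.node j x.source l ≤ x.source := by
    intro l
    rcases eq_or_ne l j with rfl | hl
    · simp
    · simpa [hl] using h.node_le_source l
  constructor
  · exact hle
  · rintro j' hj'
    obtain rfl : j = j' := by simpa [step] using hj'
    simpa [step] using hle
  · have : ¬ ∀ l, c (.sourceTo l) = 0 := fun h => by simpa [h1] using h j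
    simp [chainStep, step, this, hu]
  · rcases eq_or_ne i j with rfl | hij
    · simp [chainStep, step, h1, hu]
    · simp [chainStep, step, hs i hij, hu, hg, hij, h.nodeAge]
  · rintro j' hj' hne
    obtain rfl : j = j' := by simpa [step] using hj'
    have hex : ∃ l : {j : Fin n // j ≠ i}, c (.sourceTo l) ≠ 0 := ⟨⟨j, hne⟩, by simp [h1]⟩
    simp only [chainStep, dif_pos hex]
    -- Only `j` hears from the source in this cell, so the arbitrary choice made by `chainStep` must
    -- be `j`.
    by_contra hcon
    exact hex.choose_spec (hs _ hcon)

lemma Matches.chainStep_gossip (h : Matches i x s) {j l : Fin n} {hjl : j ≠ l}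
    (h1 : c (.gossip j l hjl) = 1) (hc : ∀ e, e ≠ .gossip j l hjl → c e = 0) :
    Matches i (step (.gossip j l hjl) x) (chainStep i c s) := by
  have hu : c .selfUpdate = 0 := hc _ (by simp)
  have hs : ∀ l, c (.sourceTo l) = 0 := fun l => hc _ (by simp)
  have hstep : chainStep i c s =
      (s.1, if c (.gossip s.2.2 i s.2.2.2) = 0 then s.2.1 else s.1, s.2.2) := by
    simp [chainStep, hu, hs]
  rw [hstep]
  by_cases hgj : x.gossiper = some j
  · have hmax : max (x.node j) (x.node l) = x.node j :=
      max_eq_left (h.node_le_gossiper j hgj l)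
    have hx : step (.gossip j l hjl) x =
        { x with node := Function.update x.node l (x.node j) } := by
      simp [step, hgj, hmax]
    have hle : ∀ l', Function.update x.node l (x.node j) l' ≤ x.node j := by
      intro l'
      rcases eq_or_ne l' l with rfl | hl
      · simp
      · simpa [hl] using h.node_le_gossiper j hgj l'
    rw [hx]
    constructor
    · exact fun l' => (hle l').trans (h.node_le_source j)
    · rintro j' hj'
      obtain rfl : j = j' := by simpa [hgj] using hj'
      simpa [hjl] using hle
    · have := h.gossiperAge
      simp only [hgj, Option.getD_some] at this
      simp [hgj, hjl, this]
    · rcases eq_or_ne l i with rfl | hli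
      · have hj : (s.2.2 : Fin n) = j := h.sender j hgj hjl
        have hc1 : c (.gossip s.2.2 l s.2.2.2) = 1 := by simpa [hj] using h1
        have := h.gossiperAge
        simp only [hgj, Option.getD_some] at this
        simp [hc1, this]
      · have hc0 : c (.gossip s.2.2 i s.2.2.2) = 0 := hc _ (by simp [hli.symm])
        simp [hc0, hli.symm, h.nodeAge]
    · exact h.sender
  · have hx : step (.gossip j l hjl) x = x := by simp [step, hgj]
    -- The network ignores this event. The chain can react only if no node gossips or `i` does, and
    -- then both ages coincide.
    have ha : (if c (.gossip s.2.2 i s.2.2.2) = 0 then s.2.1 else s.1) = s.2.1 := by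
      split_ifs with hc0
      · rfl
      · rw [h.gossiperAge, h.nodeAge]
        rcases hg : x.gossiper with _ | j'
        · rfl
        · rcases eq_or_ne j' i with rfl | hj'
          · rfl
          · refine absurd (hc _ ?_) hc0
            intro heq
            have h2 : (s.2.2 : Fin n) = j := by
              simp only [Event.gossip.injEq] at heq
              exact heq.1
            exact hgj (by rw [hg, ← h2, h.sender j' hg hj'])
    rw [hx, ha]
    exact ⟨h.node_le_source, h.node_le_gossiper, h.gossiperAge, h.nodeAge, h.sender⟩

lemma Matches.chainStep_event (h : Matches i x s) {e : Event n} (h1 : c e = 1)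
    (hc : ∀ e', e' ≠ e → c e' = 0) : Matches i (step e x) (chainStep i c s) := by
  cases e with
  | selfUpdate => exact h.chainStep_selfUpdate h1 hc
  | sourceTo j => exact h.chainStep_sourceTo h1 hc
  | gossip j l hjl => exact h.chainStep_gossip h1 hc

lemma matches_init {x₀ : NetState n} (hg : x₀.gossiper = none)
    (hx : ∀ l, x₀.node l ≤ x₀.source) (j : {j : Fin n // j ≠ i}) :
    Matches i x₀ (x₀.source - x₀.node i, x₀.source - x₀.node i, j) := by
  constructor <;> simp [hg, hx]

/-- Along a grid whose cells contain at most one event each, the chain follows the network. -/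
lemma matches_chain {N : Event n → ℝ≥0 → ℕ} {X : ℝ≥0 → NetState n}
    (hmono : ∀ e, Monotone (N e)) (h0 : Matches i (X 0) s)
    (hno : ∀ s t, s ≤ t → (∀ e, N e t = N e s) → X t = X s)
    (hone : ∀ s t, s ≤ t → ∀ e, N e t = N e s + 1 → (∀ e', e' ≠ e → N e' t = N e' s) →
      X t = step e (X s))
    (h : ℝ≥0) (m : ℕ)
    (hgood : ∀ k < m, AtMostOneEvent fun e => N e ((k + 1 : ℕ) * h) - N e (k * h)) :
    Matches i (X (m * h))
      (chain i s (fun k e => N e ((k + 1 : ℕ) * h) - N e (k * h)) m) := by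
  induction m with
  | zero => simpa [chain] using h0
  | succ m ih =>
    have hM := ih fun k hk => hgood k (Nat.lt_succ_of_lt hk)
    have hle : (m : ℝ≥0) * h ≤ (m + 1 : ℕ) * h := by gcongr; simp
    have hN := fun e => hmono e hle
    rcases hgood m (Nat.lt_succ_self m) with hz | ⟨e, he, hz⟩
    · rw [hno _ _ hle fun e => le_antisymm (Nat.sub_eq_zero_iff_le.1 (hz e)) (hN e)]
      exact hM.chainStep_of_forall_eq_zero hz
    · rw [hone _ _ hle e (by have := hN e; dsimp only at he; omega) fun e' he' =>
        le_antisymm (Nat.sub_eq_zero_iff_le.1 (hz e' he')) (hN e')]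
      exact hM.chainStep_event he hz

end Gossip

/-! ### The recurrences: decay to the fixed point and the small-mesh limit -/

section Recurrence

/-- The deviation of d decays like γ^k and feeds that of a. A common bound γ for both multipliers
covers the resonant case p = Q at the price of the factor k. -/
lemma abs_sub_le_of_recurrence {d a : ℕ → ℝ} {p Q w q γ ds as : ℝ} (hγ : 0 < γ)
    (hp : |p| ≤ γ) (hQ : |Q| ≤ γ) (hd : ∀ k, d (k + 1) = p * d k + q)
    (ha : ∀ k, a (k + 1) = Q * a k + w * d k + q) (hds : ds = p * ds + q)
    (has : as = Q * as + w * ds + q) (k : ℕ) :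
    |a k - as| ≤ γ ^ k * (|a 0 - as| + |d 0 - ds| * (k * (|w| / γ))) := by
  have hd' : ∀ k, |d k - ds| ≤ γ ^ k * |d 0 - ds| := by
    intro k
    induction k with
    | zero => simp
    | succ k ih =>
      have e : d (k + 1) - ds = p * (d k - ds) := by linear_combination hd k - hds
      rw [e, abs_mul, pow_succ', mul_assoc]
      exact mul_le_mul hp ih (abs_nonneg _) hγ.le
  induction k with
  | zero => simp
  | succ k ih =>
    have e : a (k + 1) - as = Q * (a k - as) + w * (d k - ds) := by
      linear_combination ha k - has
    rw [e]
    calc |Q * (a k - as) + w * (d k - ds)| ≤ |Q| * |a k - as| + |w| * |d k - ds| := by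
          rw [← abs_mul, ← abs_mul]; exact abs_add_le _ _
      _ ≤ γ * (γ ^ k * (|a 0 - as| + |d 0 - ds| * (k * (|w| / γ)))) +
          |w| * (γ ^ k * |d 0 - ds|) := by
          gcongr
          exact hd' k
      _ = _ := by
          push_cast
          field_simp
          ring

lemma tendsto_one_sub_exp_div (c : ℝ) :
    Tendsto (fun h : ℝ => (1 - Real.exp (-(c * h))) / h) (𝓝[≠] 0) (𝓝 c) := by
  have h : HasDerivAt (fun h : ℝ => 1 - Real.exp (-(c * h))) c 0 := by
    have := ((((hasDerivAt_id (0 : ℝ)).const_mul c).neg).exp).const_sub 1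
    simpa using this
  refine (h.tendsto_slope_zero).congr fun x => ?_
  simp [div_eq_inv_mul]

lemma tendsto_fixedPoint_gossiperAge {l : ℝ} (hl : l ≠ 0) (v : ℝ) :
    Tendsto (fun h : ℝ => v * h / (1 - Real.exp (-(l * h)))) (𝓝[≠] 0) (𝓝 (v / l)) := by
  refine ((tendsto_const_nhds (x := v)).div (tendsto_one_sub_exp_div l) hl).congr fun h => ?_
  rw [Pi.div_apply, div_div_eq_mul_div]

lemma tendsto_exp_sub_exp_div (r s : ℝ) :
    Tendsto (fun h : ℝ => (Real.exp (-(r * h)) - Real.exp (-((r + s) * h))) / h) (𝓝[≠] 0)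
      (𝓝 s) := by
  have h := (tendsto_one_sub_exp_div (r + s)).sub (tendsto_one_sub_exp_div r)
  rw [add_sub_cancel_left] at h
  exact h.congr fun x => by ring

/-- The quotient is the fixed point of the node-age recurrence at mesh h. Dividing numerator and
denominator by h leaves difference quotients of exponentials. -/
lemma tendsto_fixedPoint_nodeAge {l r s : ℝ} (hl : l ≠ 0) (hrs : r + s ≠ 0) (v : ℝ) :
    Tendsto (fun h : ℝ => ((Real.exp (-(r * h)) - Real.exp (-((r + s) * h))) *
        (v * h / (1 - Real.exp (-(l * h)))) + v * h) / (1 - Real.exp (-((r + s) * h))))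
      (𝓝[≠] 0) (𝓝 ((v + s * (v / l)) / (r + s))) := by
  refine ((((tendsto_const_nhds (x := v)).add ((tendsto_exp_sub_exp_div r s).mul
    (tendsto_fixedPoint_gossiperAge hl v))).div (tendsto_one_sub_exp_div (r + s)) hrs)).congr' ?_
  filter_upwards [self_mem_nhdsWithin] with h (hh : h ≠ 0)
  rw [Pi.div_apply, div_div_eq_mul_div]
  congr 1
  field_simp
  ring

/-- If the mean ages of the chains of mesh `t / m` evolve linearly, then their limit as `m → ∞` is
exponentially close to the stationary value. -/
lemma abs_limit_sub_le {l r s v t a₀ L : ℝ} (hl : 0 < l) (hr : 0 < r) (hs : 0 < s) (ht : 0 < t)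
    {d a : ℕ → ℕ → ℝ} (hd0 : ∀ m, d m 0 = a₀) (ha0 : ∀ m, a m 0 = a₀)
    (hd : ∀ m k, d m (k + 1) =
      Real.exp (-(l * (t / (m + 1 : ℕ)))) * d m k + v * (t / (m + 1 : ℕ)))
    (ha : ∀ m k, a m (k + 1) = Real.exp (-((r + s) * (t / (m + 1 : ℕ)))) * (a m k - d m k) +
      Real.exp (-(r * (t / (m + 1 : ℕ)))) * d m k + v * (t / (m + 1 : ℕ)))
    (hL : Tendsto (fun m => a m (m + 1)) atTop (𝓝 L)) :
    |L - (v + s * (v / l)) / (r + s)| ≤ Real.exp (-(min l (r + s) * t)) *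
      (|a₀ - (v + s * (v / l)) / (r + s)| + |a₀ - v / l| * (t * s)) := by
  set c := min l (r + s) with hc
  have hrs : 0 < r + s := by positivity
  let h : ℕ → ℝ := fun m => t / (m + 1 : ℕ)
  have hpos : ∀ m, 0 < h m := fun m => by positivity
  have hh : Tendsto h atTop (𝓝[≠] 0) := by
    refine tendsto_nhdsWithin_iff.2 ⟨?_, Eventually.of_forall fun m => (hpos m).ne'⟩
    exact (tendsto_const_div_atTop_nhds_zero_nat t).comp (tendsto_add_atTop_nat 1)
  have hmul : ∀ m, ((m + 1 : ℕ) : ℝ) * h m = t := fun m => by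
    simp only [h]
    field_simp
  let w : ℝ → ℝ := fun h => Real.exp (-(r * h)) - Real.exp (-((r + s) * h))
  let ds : ℝ → ℝ := fun h => v * h / (1 - Real.exp (-(l * h)))
  let as : ℝ → ℝ := fun h => (w h * ds h + v * h) / (1 - Real.exp (-((r + s) * h)))
  have hne : ∀ {b : ℝ}, 0 < b → ∀ m, 1 - Real.exp (-(b * h m)) ≠ 0 := by
    intro b hb m
    have : Real.exp (-(b * h m)) < 1 := by simpa using mul_pos hb (hpos m)
    linarith
  have hbound : ∀ m, |a m (m + 1) - as (h m)| ≤ Real.exp (-(c * t)) *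
      (|a₀ - as (h m)| + |a₀ - ds (h m)| *
        (t * (|w (h m) / h m| / Real.exp (-(c * h m))))) := by
    intro m
    have hk := abs_sub_le_of_recurrence (d := d m) (a := a m) (p := Real.exp (-(l * h m)))
      (Q := Real.exp (-((r + s) * h m))) (w := w (h m)) (q := v * h m)
      (γ := Real.exp (-(c * h m))) (ds := ds (h m)) (as := as (h m)) (Real.exp_pos _)
      (by
        rw [abs_of_pos (Real.exp_pos _)]
        have := mul_le_mul_of_nonneg_right (min_le_left l (r + s)) (hpos m).le
        exact Real.exp_le_exp.2 (by linarith))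
      (by
        rw [abs_of_pos (Real.exp_pos _)]
        have := mul_le_mul_of_nonneg_right (min_le_right l (r + s)) (hpos m).le
        exact Real.exp_le_exp.2 (by linarith))
      (hd m) (fun k => by rw [ha m k]; simp only [w, h]; ring)
      (by
        have := div_mul_cancel₀ (v * h m) (hne hl m)
        linear_combination this)
      (by
        have := div_mul_cancel₀ (w (h m) * ds (h m) + v * h m) (hne hrs m)
        linear_combination this)
      (m + 1)
    have e1 : Real.exp (-(c * h m)) ^ (m + 1) = Real.exp (-(c * t)) := by
      rw [← Real.exp_nat_mul, ← hmul m]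
      congr 1
      ring
    -- The coupling `w` is of order h, which compensates the linear factor m + 1 = t / h.
    have e2 : ((m + 1 : ℕ) : ℝ) * (|w (h m)| / Real.exp (-(c * h m))) =
        t * (|w (h m) / h m| / Real.exp (-(c * h m))) := by
      rw [abs_div, abs_of_pos (hpos m), ← hmul m]
      have := (hpos m).ne'
      field_simp
    rwa [e1, e2, hd0, ha0] at hk
  have l1 : Tendsto (fun m => as (h m)) atTop (𝓝 ((v + s * (v / l)) / (r + s))) :=
    (tendsto_fixedPoint_nodeAge hl.ne' hrs.ne' v).comp hh
  have l2 : Tendsto (fun m => ds (h m)) atTop (𝓝 (v / l)) :=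
    (tendsto_fixedPoint_gossiperAge hl.ne' v).comp hh
  have l3 : Tendsto (fun m => w (h m) / h m) atTop (𝓝 s) := (tendsto_exp_sub_exp_div r s).comp hh
  have l4 : Tendsto (fun m => Real.exp (-(c * h m))) atTop (𝓝 1) := by
    have : Tendsto (fun x : ℝ => Real.exp (-(c * x))) (𝓝 0) (𝓝 (Real.exp (-(c * 0)))) :=
      Continuous.tendsto (by fun_prop) 0
    simp only [mul_zero, neg_zero, Real.exp_zero] at this
    exact this.comp (hh.mono_right nhdsWithin_le_nhds)
  have hlim := ((l1.const_sub a₀).abs.add ((l2.const_sub a₀).abs.mul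
    ((l3.abs.div l4 one_ne_zero).const_mul t))).const_mul (Real.exp (-(c * t)))
  rw [div_one, abs_of_pos hs] at hlim
  exact le_of_tendsto_of_tendsto (hL.sub l1).abs hlim (Eventually.of_forall hbound)

lemma tendsto_exp_neg_mul_mul {c : ℝ} (hc : 0 < c) (x y : ℝ) :
    Tendsto (fun t : ℝ => Real.exp (-(c * t)) * (x + y * t)) atTop (𝓝 0) := by
  have hct : Tendsto (fun t : ℝ => c * t) atTop atTop := tendsto_id.const_mul_atTop hc
  have h0 := ((Real.tendsto_pow_mul_exp_neg_atTop_nhds_zero 0).comp hct).const_mul x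
  have h1 := ((Real.tendsto_pow_mul_exp_neg_atTop_nhds_zero 1).comp hct).const_mul (y / c)
  have := h0.add h1
  simp only [mul_zero, add_zero] at this
  refine this.congr fun t => ?_
  simp only [Function.comp, pow_zero, one_mul, pow_one]
  field_simp

end Recurrence

/-! ### From fine grids to the network in continuous time -/

lemma IsPoissonProcess.integrable {Ω : Type*} [MeasurableSpace Ω] {P : Measure Ω} {r : ℝ≥0}
    {N : ℝ≥0 → Ω → ℕ} (hN : IsPoissonProcess P r N) (t : ℝ≥0) :
    Integrable (fun ω => (N t ω : ℝ)) P := by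
  have h := integrable_cast_poissonMeasure (r * (t - 0))
  rw [← (hN.law_increment 0 t (zero_le)).map_eq] at h
  refine (h.comp_measurable ((hN.measurable t).sub (hN.measurable 0))).congr ?_
  filter_upwards [hN.zero] with ω h0
  simp [h0]

namespace Gossip

section Network

variable {Ω : Type*} [MeasurableSpace Ω] {P : Measure Ω} {n : ℕ}
  {lamE lam B : ℝ≥0} {N : Event n → ℝ≥0 → Ω → ℕ} {X : ℝ≥0 → Ω → NetState n}

/-- The event that some cell of the grid of mesh `t / (m + 1)` on `(0, t]` contains two events. -/
def crowded (N : Event n → ℝ≥0 → Ω → ℕ) (t : ℝ≥0) (m : ℕ) : Set Ω :=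
  {ω | ∃ k < m + 1, ¬ AtMostOneEvent fun e => gridIncrement (N e) (t / (m + 1 : ℕ)) k ω}

/-- The chain following node `i` along the grid of mesh `t / (m + 1)`. -/
noncomputable def gridChain (N : Event n → ℝ≥0 → Ω → ℕ) (i : Fin n) (s₀ : ChainState i) (t : ℝ≥0)
    (m k : ℕ) (ω : Ω) : ChainState i :=
  chain i s₀ (fun k e => gridIncrement (N e) (t / (m + 1 : ℕ)) k ω) k

lemma IsSemiDistributed.isPoissonArray (hX : IsSemiDistributed P n lamE lam B N X) (h : ℝ≥0) :
    IsPoissonArray P (fun e => rate lamE lam B e * h) (fun e => gridIncrement (N e) h) :=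
  isPoissonArray_gridIncrement hX.poisson hX.indep h

lemma IsSemiDistributed.measurableSet_crowded (hX : IsSemiDistributed P n lamE lam B N X)
    (t : ℝ≥0) (m : ℕ) : MeasurableSet (crowded N t m) := by
  have hη := hX.isPoissonArray (t / (m + 1 : ℕ))
  have hset : crowded N t m = ⋃ k ∈ Finset.range (m + 1),
      (fun ω e => gridIncrement (N e) (t / (m + 1 : ℕ)) k ω) ⁻¹' {x | ¬ AtMostOneEvent x} := by
    ext; simp [crowded]
  rw [hset]
  exact Finset.measurableSet_biUnion _ fun k _ =>
    (measurable_pi_lambda _ fun e => hη.measurable e k) MeasurableSet.of_discrete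

/-- There are m + 1 cells, each crowded with probability O((t/(m + 1))²). -/
lemma IsSemiDistributed.tendsto_crowded [IsProbabilityMeasure P]
    (hX : IsSemiDistributed P n lamE lam B N X) (t : ℝ≥0) :
    Tendsto (fun m => P (crowded N t m)) atTop (𝓝 0) := by
  let r : Event n → ℝ := fun e => rate lamE lam B e
  let K : ℝ := ∑ e, r e ^ 2 + ∑ e, ∑ e', r e * r e'
  have hle : ∀ m, P.real (crowded N t m) ≤ (t : ℝ) ^ 2 * K / (m + 1 : ℕ) := by
    intro m
    refine ((hX.isPoissonArray (t / (m + 1 : ℕ))).real_exists_not_atMostOneEvent_le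
      (m + 1)).trans_eq ?_
    have e1 : ∀ x y z : ℝ, x * z * (y * z) = x * y * z ^ 2 := fun x y z => by ring
    simp only [NNReal.coe_mul, mul_pow, e1, ← Finset.sum_mul, ← add_mul, NNReal.coe_div,
      NNReal.coe_natCast]
    change _ * (K * _) = _
    field_simp
  have h0 : Tendsto (fun m : ℕ => (t : ℝ) ^ 2 * K / (m + 1 : ℕ)) atTop (𝓝 0) :=
    (tendsto_const_div_atTop_nhds_zero_nat _).comp (tendsto_add_atTop_nat 1)
  have h1 := squeeze_zero (fun m => measureReal_nonneg) hle h0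
  have h2 := ENNReal.tendsto_ofReal h1
  simpa using h2

lemma IsSemiDistributed.ae_exists_notMem_crowded [IsProbabilityMeasure P]
    (hX : IsSemiDistributed P n lamE lam B N X) (t : ℝ≥0) :
    ∀ᵐ ω ∂P, ∃ m, ω ∉ crowded N t m := by
  rw [ae_iff]
  refine le_antisymm (ge_of_tendsto' (hX.tendsto_crowded t) fun m => measure_mono ?_) (zero_le)
  intro ω hω
  by_contra hc
  exact hω ⟨m, hc⟩

/-- One `a₀` and one null set serve all t and m. The initial sender `j` is arbitrary because no node
gossips at time 0. -/
lemma IsSemiDistributed.exists_age_eq_gridChain (hX : IsSemiDistributed P n lamE lam B N X)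
    (i : Fin n) (j : {j : Fin n // j ≠ i}) :
    ∃ a₀ : ℕ, ∀ᵐ ω ∂P, ∀ t m, ω ∉ crowded N t m →
      (X t ω).age i = (gridChain N i (a₀, a₀, j) t m (m + 1) ω).2.1 := by
  obtain ⟨x₀, hg, hx, h0⟩ := hX.init
  refine ⟨x₀.source - x₀.node i, ?_⟩
  have hmono : ∀ᵐ ω ∂P, ∀ e, Monotone fun t => N e t ω :=
    ae_all_iff.2 fun e => (hX.poisson e).mono
  filter_upwards [h0, hmono, hX.no_event, hX.one_event] with ω h0 hmono hno hone t m hm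
  have hM : Matches i (X 0 ω) (x₀.source - x₀.node i, x₀.source - x₀.node i, j) := by
    rw [h0]
    exact matches_init hg hx j
  have hgood : ∀ k < m + 1, AtMostOneEvent fun e =>
      gridIncrement (N e) (t / (m + 1 : ℕ)) k ω := by
    intro k hk
    by_contra hc
    exact hm ⟨k, hk, hc⟩
  have h := matches_chain (N := fun e t => N e t ω) (X := fun t => X t ω) hmono hM hno hone
    (t / (m + 1 : ℕ)) (m + 1) hgood
  have ht : ((m + 1 : ℕ) : ℝ≥0) * (t / (m + 1 : ℕ)) = t :=
    mul_div_cancel₀ t (Nat.cast_ne_zero.2 m.succ_ne_zero)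
  rw [ht] at h
  exact h.age_eq

lemma IsSemiDistributed.ae_gridChain_le (hX : IsSemiDistributed P n lamE lam B N X)
    (i : Fin n) (j : {j : Fin n // j ≠ i}) (a₀ : ℕ) (t : ℝ≥0) :
    ∀ᵐ ω ∂P, ∀ m, (gridChain N i (a₀, a₀, j) t m (m + 1) ω).2.1 ≤ a₀ + N .selfUpdate t ω := by
  filter_upwards [(hX.poisson .selfUpdate).mono] with ω hmono m
  refine (chain_le i a₀ j _ (m + 1)).2.trans (Nat.add_le_add_left ?_ _)
  have hm : Monotone fun k : ℕ => N .selfUpdate (k * (t / (m + 1 : ℕ))) ω := fun a b hab =>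
    hmono (by gcongr)
  have h := Finset.sum_range_tsub hm (m + 1)
  have ht : ((m + 1 : ℕ) : ℝ≥0) * (t / (m + 1 : ℕ)) = t :=
    mul_div_cancel₀ t (Nat.cast_ne_zero.2 m.succ_ne_zero)
  rw [ht] at h
  exact h.trans_le (Nat.sub_le _ _)

variable [IsProbabilityMeasure P]

/-- Both ages lie between 0 and `a₀` plus the number of new versions, and they agree off the crowded
event. Their means thus differ by at most the integral of that bound over an event of vanishing
probability. -/
lemma IsSemiDistributed.exists_tendsto_gridChain (hX : IsSemiDistributed P n lamE lam B N X)
    (i : Fin n) (j : {j : Fin n // j ≠ i}) :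
    ∃ a₀ : ℕ, ∀ t, Integrable (fun ω => (X t ω).age i) P ∧
      Tendsto (fun m => ∫ ω, ((gridChain N i (a₀, a₀, j) t m (m + 1) ω).2.1 : ℝ) ∂P) atTop
        (𝓝 (∫ ω, (X t ω).age i ∂P)) := by
  obtain ⟨a₀, h⟩ := hX.exists_age_eq_gridChain i j
  refine ⟨a₀, fun t => ?_⟩
  have hle := hX.ae_gridChain_le i j a₀ t
  have hb : Integrable (fun ω => (a₀ : ℝ) + N .selfUpdate t ω) P :=
    (integrable_const _).add ((hX.poisson _).integrable t)
  have hage : ∀ᵐ ω ∂P, 0 ≤ (X t ω).age i ∧ (X t ω).age i ≤ a₀ + N .selfUpdate t ω := by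
    filter_upwards [h, hle, hX.ae_exists_notMem_crowded t] with ω h hle ⟨m, hm⟩
    rw [h t m hm]
    exact ⟨Nat.cast_nonneg _, by exact_mod_cast hle m⟩
  have hmeas : Measurable fun ω => (X t ω).age i :=
    (measurable_from_top (f := fun x : NetState n => x.age i)).comp (hX.measurable t)
  have hint : Integrable (fun ω => (X t ω).age i) P := by
    refine hb.mono' hmeas.aestronglyMeasurable ?_
    filter_upwards [hage] with ω hω
    rw [Real.norm_of_nonneg hω.1]
    exact hω.2
  refine ⟨hint, ?_⟩
  have hchain : ∀ m, Integrable
      (fun ω => ((gridChain N i (a₀, a₀, j) t m (m + 1) ω).2.1 : ℝ)) P := fun m =>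
    integrable_chain (hX.isPoissonArray (t / (m + 1 : ℕ))) i a₀ j (m + 1) (fun s => s.2.1)
      fun _ => Or.inr le_rfl
  have hdist : ∀ m, |∫ ω, ((gridChain N i (a₀, a₀, j) t m (m + 1) ω).2.1 : ℝ) ∂P -
      ∫ ω, (X t ω).age i ∂P| ≤ ∫ ω in crowded N t m, ((a₀ : ℝ) + N .selfUpdate t ω) ∂P := by
    intro m
    rw [← integral_sub (hchain m) hint, ← integral_indicator (hX.measurableSet_crowded t m)]
    refine (abs_integral_le_integral_abs).trans (integral_mono_ae ((hchain m).sub hint).abs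
      (hb.indicator (hX.measurableSet_crowded t m)) ?_)
    filter_upwards [h, hle, hage] with ω h hle hω
    by_cases hm : ω ∈ crowded N t m
    · simp only [Set.indicator_of_mem hm]
      have h1 : ((gridChain N i (a₀, a₀, j) t m (m + 1) ω).2.1 : ℝ) ≤
          a₀ + N .selfUpdate t ω := by exact_mod_cast hle m
      have h2 : (0 : ℝ) ≤ ((gridChain N i (a₀, a₀, j) t m (m + 1) ω).2.1 : ℝ) :=
        Nat.cast_nonneg _
      exact abs_sub_le_iff.2 ⟨by linarith [hω.1], by linarith [hω.2]⟩
    · simp only [Set.indicator_of_notMem hm]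
      rw [h t m hm, sub_self, abs_zero]
  have hzero := hb.tendsto_setIntegral_nhds_zero (hX.tendsto_crowded t)
  rw [tendsto_iff_norm_sub_tendsto_zero]
  exact squeeze_zero (fun m => norm_nonneg _) hdist hzero

/-- The steady-state mean version age. -/
noncomputable def meanAge (lamE lam : ℝ≥0) (n : ℕ) (B : ℝ≥0) : ℝ :=
  ((lamE : ℝ) + (B : ℝ) / ((n : ℝ) - 1) * ((lamE : ℝ) / (lam : ℝ))) /
    ((lam : ℝ) / (n : ℝ) + (B : ℝ) / ((n : ℝ) - 1))

theorem IsSemiDistributed.integrable_and_tendsto (hX : IsSemiDistributed P n lamE lam B N X)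
    (hlam : 0 < lam) (hB : 0 < B) (hn : 2 ≤ n) (i : Fin n) :
    (∀ t, Integrable (fun ω => (X t ω).age i) P) ∧
      Tendsto (fun t : ℝ≥0 => ∫ ω, (X t ω).age i ∂P) atTop (𝓝 (meanAge lamE lam n B)) := by
  have : Nontrivial (Fin n) := Fin.nontrivial_iff_two_le.2 hn
  -- A second node is needed as the chain's initial sender.
  obtain ⟨j, hj⟩ := exists_ne i
  obtain ⟨a₀, h⟩ := hX.exists_tendsto_gridChain i ⟨j, hj⟩
  refine ⟨fun t => (h t).1, ?_⟩
  have hn0 : (0 : ℝ) < n := by exact_mod_cast (by omega : 0 < n)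
  have hn1 : (0 : ℝ) < (n : ℝ) - 1 := by
    have : (2 : ℝ) ≤ n := by exact_mod_cast hn
    linarith
  have hcast : ((n - 1 : ℕ) : ℝ) = (n : ℝ) - 1 := by
    rw [Nat.cast_sub (by omega), Nat.cast_one]
  have hl : (0 : ℝ) < lam := hlam
  have hr : (0 : ℝ) < lam / n := by positivity
  have hs : (0 : ℝ) < B / ((n : ℝ) - 1) := div_pos hB hn1
  have hbound : ∀ t : ℝ≥0, 0 < t → |∫ ω, (X t ω).age i ∂P - meanAge lamE lam n B| ≤
      Real.exp (-(min (lam : ℝ) (lam / n + B / ((n : ℝ) - 1)) * t)) *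
        (|(a₀ : ℝ) - meanAge lamE lam n B| +
          |(a₀ : ℝ) - lamE / lam| * (t * (B / ((n : ℝ) - 1)))) := by
    intro t ht
    refine abs_limit_sub_le (v := lamE) (t := t) (a₀ := a₀) hl hr hs ht
      (d := fun m k => ∫ ω, ((gridChain N i (a₀, a₀, ⟨j, hj⟩) t m k ω).1 : ℝ) ∂P)
      (a := fun m k => ∫ ω, ((gridChain N i (a₀, a₀, ⟨j, hj⟩) t m k ω).2.1 : ℝ) ∂P)
      (fun m => by simp [gridChain, chain]) (fun m => by simp [gridChain, chain])
      (fun m k => ?_) (fun m k => ?_) (h t).2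
    · refine (integral_gossiperAge_succ (hX.isPoissonArray (t / (m + 1 : ℕ))) i a₀ ⟨j, hj⟩
        k).trans ?_
      have e : ∑ l : Fin n, ((rate lamE lam B (.sourceTo l) * (t / (m + 1 : ℕ)) : ℝ≥0) : ℝ) =
          lam * (t / (m + 1 : ℕ)) := by
        simp [rate]
        field_simp
      rw [e]
      simp [gridChain, rate]
    · refine (integral_nodeAge_succ (hX.isPoissonArray (t / (m + 1 : ℕ))) i a₀ ⟨j, hj⟩
        k (σ := B / ((n - 1 : ℕ) : ℝ≥0) * (t / (m + 1 : ℕ))) fun l h => rfl).trans ?_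
      simp only [rate, NNReal.coe_mul, NNReal.coe_div, NNReal.coe_natCast, hcast, add_mul]
      rfl
  have hc : 0 < min (lam : ℝ) (lam / n + B / ((n : ℝ) - 1)) := lt_min hl (by positivity)
  have hlim := (tendsto_exp_neg_mul_mul hc |(a₀ : ℝ) - meanAge lamE lam n B|
    (|(a₀ : ℝ) - lamE / lam| * (B / ((n : ℝ) - 1)))).comp
      (NNReal.tendsto_coe_atTop.2 tendsto_id)
  rw [tendsto_iff_norm_sub_tendsto_zero]
  refine squeeze_zero' (Eventually.of_forall fun t => norm_nonneg _) ?_ hlim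
  filter_upwards [eventually_gt_atTop 0] with t ht
  refine (hbound t ht).trans_eq ?_
  simp only [Function.comp, id]
  ring

end Network

/-! ### Many nodes with gossip rate B = nλ -/

lemma tendsto_meanAge_mul (lamE : ℝ≥0) {lam : ℝ≥0} (hlam : 0 < lam) :
    Tendsto (fun n : ℕ => meanAge lamE lam n (n * lam)) atTop
      (𝓝 (2 * (lamE : ℝ) / (lam : ℝ))) := by
  have hl : (lam : ℝ) ≠ 0 := by exact_mod_cast hlam.ne'
  have h1 : Tendsto (fun n : ℕ => (lam : ℝ) / n) atTop (𝓝 0) :=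
    tendsto_const_div_atTop_nhds_zero_nat _
  have h2 : Tendsto (fun n : ℕ => ((n * lam : ℝ≥0) : ℝ) / ((n : ℝ) - 1)) atTop (𝓝 lam) := by
    have h3 : Tendsto (fun n : ℕ => (lam : ℝ) / (1 - 1 / n)) atTop (𝓝 (lam / (1 - 0))) :=
      tendsto_const_nhds.div (tendsto_const_nhds.sub (tendsto_const_div_atTop_nhds_zero_nat 1))
        (by norm_num)
    rw [sub_zero, div_one] at h3
    refine h3.congr' ?_
    filter_upwards [eventually_ge_atTop 2] with n hn
    have hn' : (2 : ℝ) ≤ n := by exact_mod_cast hn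
    have : (n : ℝ) - 1 ≠ 0 := by linarith
    push_cast
    field_simp
  have h := ((tendsto_const_nhds (x := (lamE : ℝ))).add (h2.mul_const ((lamE : ℝ) / lam))).div
    (h1.add h2) (by simpa using hl)
  have e : ((lamE : ℝ) + lam * (lamE / lam)) / (0 + lam) = 2 * lamE / lam := by
    field_simp
    ring
  rw [e] at h
  exact h

end Gossip

theorem theorem1 (lamE lam : ℝ≥0) (hlamE : 0 < lamE) (hlam : 0 < lam) :
    ∃ a : ℕ → ℝ≥0 → ℝ,
      -- `a n B` is the steady-state mean version age of every node
      (∀ (n : ℕ) (B : ℝ≥0), 2 ≤ n → 0 < B →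
        ∀ (Ω : Type*) [MeasurableSpace Ω] (P : Measure Ω) [IsProbabilityMeasure P]
          (N : Gossip.Event n → ℝ≥0 → Ω → ℕ) (X : ℝ≥0 → Ω → Gossip.NetState n),
          Gossip.IsSemiDistributed P n lamE lam B N X → ∀ i : Fin n,
            (∀ t, Integrable (fun ω => (X t ω).age i) P) ∧
            Tendsto (fun t : ℝ≥0 => ∫ ω, (X t ω).age i ∂P) atTop (𝓝 (a n B))) ∧
      (∀ (n : ℕ) (B : ℝ≥0), 2 ≤ n → 0 < B →
        a n B = ((lamE : ℝ) + (B : ℝ) / ((n : ℝ) - 1) * ((lamE : ℝ) / (lam : ℝ))) /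
          ((lam : ℝ) / (n : ℝ) + (B : ℝ) / ((n : ℝ) - 1))) ∧
      -- with `B = n * lam`, this is `O(1)` and tends to `2 * lamE / lam`
      (fun n : ℕ => a n (n * lam)) =O[atTop] (fun _ => (1 : ℝ)) ∧
      Tendsto (fun n : ℕ => a n (n * lam)) atTop (𝓝 (2 * (lamE : ℝ) / (lam : ℝ))) := by
  refine ⟨Gossip.meanAge lamE lam, ?_, fun n B _ _ => rfl, ?_, Gossip.tendsto_meanAge_mul lamE hlam⟩
  · intro n B hn hB Ω _ P _ N X hX i
    exact hX.integrable_and_tendsto hlam hB hn i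
  · exact (Gossip.tendsto_meanAge_mul lamE hlam).isBigO_one ℝ
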